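/- For an integral domain $R$ with quotient field $F$ and a nonzero fractional ideal $I$ of $R$, put $I^{-1}=\{x\in F : xI\subseteq R\}$, $I_v=(I^{-1})^{-1}$, and $I_t=\bigcup J_v$, the union over the nonzero finitely generated fractional ideals $J\subseteq I$; $I$ is a $t$-ideal if $I_t=I$. The fractional $t$-ideals form a commutative monoid under $(I,J)\mapsto (IJ)_t$; let $T(R)$ be its group of invertible elements, $P(R)\subseteq T(R)$ the subgroup of nonzero principal fractional ideals, and $Cl(R)=T(R)/P(R)$ the class group. If $R$ is graded, a fractional ideal $I$ is homogeneous if $sI$ is a homogeneous integral ideal of $R$ for some nonzero homogeneous $s\in R$; the homogeneous class group $HCl(R)$ is the subgroup of $Cl(R)$ consisting of the classes of homogeneous elements of $T(R)$ (equivalently, homogeneous elements of $T(R)$ modulo homogeneous principal fractional ideals). **Corollary 1.9.** Let $A$ be an integral domain, and grade $A[X]$ by degree, with $A X^n$ in degree $n\ge 0$. The rule $[J]\mapsto [J\,A[X]]$ is a well-defined injective group homomorphism $\varphi: Cl(A)\to Cl(A[X])$ with image exactly $HCl(A[X])$; in this sense $HCl(A[X])=Cl(A)$. Moreover $$Cl(A[X])=HCl(A[X])\iff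 A \text{ is integrally closed (in its quotient field)}.$$ Equivalently (Gabelli's theorem), $Cl(A[X])=Cl(A)$, i.e. $\varphi$ is surjective, if and only if $A$ is integrally closed. -/

import Mathlib

open scoped nonZeroDivisors Polynomial

set_option linter.unusedSectionVars false

noncomputable section

namespace TClass

section Closure

variable {R K : Type*} [CommRing R] [IsDomain R] [Field K] [Algebra R K] [IsFractionRing R K]

/-- The divisorial closure `I_v = (I⁻¹)⁻¹`, where `I⁻¹ = (R : I) = {x ∈ K | x I ⊆ R}`. -/
def vClosure (I : FractionalIdeal R⁰ K) : FractionalIdeal R⁰ K := (I⁻¹)⁻¹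

lemma inv_ne_zero' {I : FractionalIdeal R⁰ K} (hI : I ≠ 0) : I⁻¹ ≠ 0 := by
  intro h
  have h2 := FractionalIdeal.bot_lt_mul_inv (K := K) (I := I) (by simpa using hI)
  rw [h, mul_zero] at h2
  exact lt_irrefl _ h2

@[simp] lemma vClosure_zero : vClosure (0 : FractionalIdeal R⁰ K) = 0 := by
  simp [vClosure, FractionalIdeal.inv_zero']

@[simp] lemma vClosure_spanSingleton (x : K) :
    vClosure (FractionalIdeal.spanSingleton R⁰ x) = FractionalIdeal.spanSingleton R⁰ x := by
  simp [vClosure]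

lemma le_vClosure (I : FractionalIdeal R⁰ K) : I ≤ vClosure I := by
  rcases eq_or_ne I 0 with rfl | hI
  · simp
  intro x hx
  refine (FractionalIdeal.mem_inv_iff (inv_ne_zero' hI)).2 fun y hy => ?_
  rw [mul_comm]
  exact (FractionalIdeal.mem_inv_iff hI).1 hy x hx

lemma vClosure_mono {I J : FractionalIdeal R⁰ K} (h : I ≤ J) : vClosure I ≤ vClosure J := by
  rcases eq_or_ne I 0 with rfl | hI
  · simp
  have hJ : J ≠ 0 := fun hJ => hI (by simpa [hJ] using h)
  exact FractionalIdeal.inv_anti_mono (inv_ne_zero' hJ) (inv_ne_zero' hI)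
    (FractionalIdeal.inv_anti_mono hI hJ h)

lemma inv_vClosure (I : FractionalIdeal R⁰ K) : (vClosure I)⁻¹ = I⁻¹ := by
  rcases eq_or_ne I 0 with rfl | hI
  · simp
  refine le_antisymm ?_ (le_vClosure I⁻¹)
  exact FractionalIdeal.inv_anti_mono hI (inv_ne_zero' (inv_ne_zero' hI)) (le_vClosure I)

lemma vClosure_vClosure (I : FractionalIdeal R⁰ K) : vClosure (vClosure I) = vClosure I := by
  rw [vClosure, inv_vClosure, vClosure]

lemma mem_inv_of_mul_le_one {I : FractionalIdeal R⁰ K} (hI : I ≠ 0) {J : FractionalIdeal R⁰ K}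
    (h : J * I ≤ 1) : J ≤ I⁻¹ := fun _ hx =>
  (FractionalIdeal.mem_inv_iff hI).2 fun _ hy => h (FractionalIdeal.mul_mem_mul hx hy)

lemma inv_mul_le_one (I : FractionalIdeal R⁰ K) : I⁻¹ * I ≤ 1 := by
  rw [mul_comm]; exact FractionalIdeal.mul_one_div_le_one

lemma mul_ne_zero' {I J : FractionalIdeal R⁰ K} (hI : I ≠ 0) (hJ : J ≠ 0) : I * J ≠ 0 := by
  intro h
  obtain ⟨x, hx, hx0⟩ := Submodule.exists_mem_ne_zero_of_ne_bot
    (fun h => hI (FractionalIdeal.coeToSubmodule_eq_bot.1 h))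
  obtain ⟨y, hy, hy0⟩ := Submodule.exists_mem_ne_zero_of_ne_bot
    (fun h => hJ (FractionalIdeal.coeToSubmodule_eq_bot.1 h))
  have hxy : x * y ∈ I * J := FractionalIdeal.mul_mem_mul hx hy
  rw [h, FractionalIdeal.mem_zero_iff] at hxy
  exact mul_ne_zero hx0 hy0 hxy

lemma vClosure_mul_le (I J : FractionalIdeal R⁰ K) : vClosure I * J ≤ vClosure (I * J) := by
  rcases eq_or_ne I 0 with rfl | hI
  · simp
  rcases eq_or_ne J 0 with rfl | hJ
  · simp
  have hIJ : I * J ≠ 0 := mul_ne_zero' hI hJ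
  refine mem_inv_of_mul_le_one (inv_ne_zero' hIJ) ?_
  have h1 : (I * J)⁻¹ * J ≤ I⁻¹ := by
    refine mem_inv_of_mul_le_one hI ?_
    rw [mul_assoc, mul_comm J I]
    exact inv_mul_le_one _
  calc vClosure I * J * (I * J)⁻¹ = vClosure I * ((I * J)⁻¹ * J) := by ring
    _ ≤ vClosure I * I⁻¹ := mul_le_mul_right h1 _
    _ ≤ 1 := inv_mul_le_one _

/-- The underlying submodule of the `t`-closure: the union of the `F_v` over all finitely generated
fractional ideals `F ⊆ I` (the choice `F = 0` contributes only the element `0`). -/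
def tClosureSubmodule (I : FractionalIdeal R⁰ K) : Submodule R K where
  carrier := {x | ∃ F : FractionalIdeal R⁰ K, (F : Submodule R K).FG ∧ F ≤ I ∧ x ∈ vClosure F}
  zero_mem' := ⟨0, by simpa using Submodule.fg_bot, FractionalIdeal.zero_le _, by simp⟩
  add_mem' := by
    rintro x y ⟨F, hF, hFI, hx⟩ ⟨G, hG, hGI, hy⟩
    refine ⟨F ⊔ G, ?_, sup_le hFI hGI, ?_⟩
    · rw [FractionalIdeal.coe_sup]
      exact hF.sup hG
    · exact Submodule.add_mem (vClosure (F ⊔ G) : Submodule R K)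
        (vClosure_mono le_sup_left hx) (vClosure_mono le_sup_right hy)
  smul_mem' := by
    rintro c x ⟨F, hF, hFI, hx⟩
    exact ⟨F, hF, hFI, Submodule.smul_mem (vClosure F : Submodule R K) c hx⟩

lemma tClosureSubmodule_le (I : FractionalIdeal R⁰ K) :
    tClosureSubmodule I ≤ (vClosure I : Submodule R K) := by
  rintro x ⟨F, -, hFI, hx⟩
  exact vClosure_mono hFI hx

/-- The `t`-closure `I_t = ⋃ F_v`, the union over all finitely generated fractional ideals
`F ⊆ I`. -/
def tClosure (I : FractionalIdeal R⁰ K) : FractionalIdeal R⁰ K :=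
  ⟨tClosureSubmodule I, FractionalIdeal.isFractional_of_le (tClosureSubmodule_le I)⟩

lemma mem_tClosure {I : FractionalIdeal R⁰ K} {x : K} : x ∈ tClosure I ↔
    ∃ F : FractionalIdeal R⁰ K, (F : Submodule R K).FG ∧ F ≤ I ∧ x ∈ vClosure F := Iff.rfl

lemma tClosure_le_vClosure (I : FractionalIdeal R⁰ K) : tClosure I ≤ vClosure I := by
  intro x hx
  obtain ⟨F, -, hFI, hx⟩ := mem_tClosure.1 hx
  exact vClosure_mono hFI hx

lemma spanSingleton_fg (x : K) :
    (FractionalIdeal.spanSingleton R⁰ x : Submodule R K).FG := by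
  rw [FractionalIdeal.coe_spanSingleton]
  exact Submodule.fg_span_singleton x

lemma le_tClosure (I : FractionalIdeal R⁰ K) : I ≤ tClosure I := fun x hx =>
  mem_tClosure.2 ⟨FractionalIdeal.spanSingleton R⁰ x, spanSingleton_fg x,
    FractionalIdeal.spanSingleton_le_iff_mem.2 hx, by
      rw [vClosure_spanSingleton]
      exact FractionalIdeal.mem_spanSingleton_self _ x⟩

lemma tClosure_mono {I J : FractionalIdeal R⁰ K} (h : I ≤ J) : tClosure I ≤ tClosure J := by
  intro x hx
  obtain ⟨F, hF, hFI, hx⟩ := mem_tClosure.1 hx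
  exact mem_tClosure.2 ⟨F, hF, hFI.trans h, hx⟩

lemma exists_fg_of_le_tClosure {I : FractionalIdeal R⁰ K} (N : Submodule R K) (hN : N.FG)
    (h : N ≤ (tClosure I : Submodule R K)) :
    ∃ G : FractionalIdeal R⁰ K, (G : Submodule R K).FG ∧ G ≤ I ∧
      N ≤ (vClosure G : Submodule R K) := by
  induction N, hN using Submodule.fg_induction with
  | singleton x =>
    obtain ⟨F, hF, hFI, hx⟩ :=
      mem_tClosure.1 (h (Submodule.mem_span_singleton_self x))
    exact ⟨F, hF, hFI, (Submodule.span_singleton_le_iff_mem _ _).2 hx⟩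
  | sup N₁ N₂ _ _ h₁ h₂ =>
    obtain ⟨F, hF, hFI, hx⟩ := h₁ (le_sup_left.trans h)
    obtain ⟨G, hG, hGI, hy⟩ := h₂ (le_sup_right.trans h)
    refine ⟨F ⊔ G, ?_, sup_le hFI hGI, sup_le (hx.trans ?_) (hy.trans ?_)⟩
    · rw [FractionalIdeal.coe_sup]
      exact hF.sup hG
    · exact vClosure_mono le_sup_left
    · exact vClosure_mono le_sup_right

lemma tClosure_tClosure (I : FractionalIdeal R⁰ K) : tClosure (tClosure I) = tClosure I := by
  refine le_antisymm ?_ (le_tClosure _)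
  intro x hx
  obtain ⟨F, hF, hFI, hx⟩ := mem_tClosure.1 hx
  obtain ⟨G, hG, hGI, h⟩ := exists_fg_of_le_tClosure (F : Submodule R K) hF hFI
  refine mem_tClosure.2 ⟨G, hG, hGI, ?_⟩
  have : vClosure F ≤ vClosure (vClosure G) := vClosure_mono h
  rw [vClosure_vClosure] at this
  exact this hx

lemma tClosure_mul_le (I J : FractionalIdeal R⁰ K) : tClosure I * J ≤ tClosure (I * J) := by
  refine FractionalIdeal.mul_le.2 ?_
  intro x hx y hy
  obtain ⟨F, hF, hFI, hx⟩ := mem_tClosure.1 hx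
  refine mem_tClosure.2 ⟨F * FractionalIdeal.spanSingleton R⁰ y, ?_, ?_, ?_⟩
  · rw [FractionalIdeal.coe_mul]
    exact hF.mul (spanSingleton_fg y)
  · exact mul_le_mul' hFI (FractionalIdeal.spanSingleton_le_iff_mem.2 hy)
  · exact vClosure_mul_le _ _
      (FractionalIdeal.mul_mem_mul hx (FractionalIdeal.mem_spanSingleton_self _ y))

lemma tClosure_tClosure_mul (I J : FractionalIdeal R⁰ K) :
    tClosure (tClosure I * J) = tClosure (I * J) := by
  refine le_antisymm ?_ (tClosure_mono (mul_le_mul_left (le_tClosure I) J))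
  rw [← tClosure_tClosure (I * J)]
  exact tClosure_mono (tClosure_mul_le I J)

@[simp] lemma tClosure_spanSingleton (x : K) :
    tClosure (FractionalIdeal.spanSingleton R⁰ x) = FractionalIdeal.spanSingleton R⁰ x :=
  le_antisymm ((tClosure_le_vClosure _).trans (vClosure_spanSingleton x).le) (le_tClosure _)

@[simp] lemma tClosure_one : tClosure (1 : FractionalIdeal R⁰ K) = 1 := by
  rw [← FractionalIdeal.spanSingleton_one, tClosure_spanSingleton]

end Closure

section ClassGroup

/-- The (fractional) `t`-ideals of `R`: the nonzero fractional ideals `I` with `I_t = I`. -/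
@[ext] structure TIdeal (R K : Type*) [CommRing R] [IsDomain R] [Field K] [Algebra R K]
    [IsFractionRing R K] where
  /-- the underlying fractional ideal -/
  toFractionalIdeal : FractionalIdeal R⁰ K
  ne_zero : toFractionalIdeal ≠ 0
  tClosure_eq : tClosure toFractionalIdeal = toFractionalIdeal

variable {R K : Type*} [CommRing R] [IsDomain R] [Field K] [Algebra R K] [IsFractionRing R K]

/-- The `t`-ideals form a commutative monoid under the `t`-multiplication `(I, J) ↦ (I J)_t`. -/
instance : CommMonoid (TIdeal R K) where
  mul I J :=
    { toFractionalIdeal := tClosure (I.toFractionalIdeal * J.toFractionalIdeal)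
      ne_zero := fun h => mul_ne_zero' I.ne_zero J.ne_zero
        (le_antisymm ((le_tClosure _).trans h.le) (FractionalIdeal.zero_le _))
      tClosure_eq := tClosure_tClosure _ }
  one := ⟨1, one_ne_zero, tClosure_one⟩
  mul_assoc I J L := TIdeal.ext <| by
    change tClosure (tClosure (_ * _) * _) = tClosure (_ * tClosure (_ * _))
    rw [tClosure_tClosure_mul, mul_comm _ (tClosure _), tClosure_tClosure_mul]
    congr 1
    ring
  one_mul I := TIdeal.ext <| by
    change tClosure (1 * _) = _
    rw [one_mul, I.tClosure_eq]
  mul_one I := TIdeal.ext <| by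
    change tClosure (_ * 1) = _
    rw [mul_one, I.tClosure_eq]
  mul_comm I J := TIdeal.ext <| by
    change tClosure (_ * _) = tClosure (_ * _)
    rw [mul_comm]

lemma TIdeal.mul_toFractionalIdeal (I J : TIdeal R K) : (I * J).toFractionalIdeal =
    tClosure (I.toFractionalIdeal * J.toFractionalIdeal) := rfl

lemma TIdeal.one_toFractionalIdeal : (1 : TIdeal R K).toFractionalIdeal = 1 := rfl

variable (R K) in
/-- `T(R)`: the group of `t`-invertible fractional `t`-ideals of `R` under `t`-multiplication. -/
abbrev TInvertible : Type _ := (TIdeal R K)ˣ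

/-- The fractional ideal underlying an element of `T(R)`. -/
def TInvertible.ideal (I : TInvertible R K) : FractionalIdeal R⁰ K := I.val.toFractionalIdeal

variable (R K) in
/-- The homomorphism `Kˣ → T(R)` sending `u` to the principal fractional ideal `u R`. -/
def principal : Kˣ →* TInvertible R K :=
  MonoidHom.toHomUnits
    { toFun := fun u => ⟨FractionalIdeal.spanSingleton R⁰ (u : K),
        FractionalIdeal.spanSingleton_ne_zero_iff.2 u.ne_zero, tClosure_spanSingleton _⟩
      map_one' := TIdeal.ext (by simp [TIdeal.one_toFractionalIdeal])
      map_mul' := fun u v => TIdeal.ext (by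
        simp [TIdeal.mul_toFractionalIdeal, FractionalIdeal.spanSingleton_mul_spanSingleton]) }

lemma inv_tClosure (I : FractionalIdeal R⁰ K) : (tClosure I)⁻¹ = I⁻¹ := by
  rcases eq_or_ne I 0 with rfl | hI
  · rw [← FractionalIdeal.spanSingleton_zero, tClosure_spanSingleton]
  have ht : tClosure I ≠ 0 := fun h =>
    hI (le_antisymm ((le_tClosure I).trans h.le) (FractionalIdeal.zero_le _))
  refine le_antisymm (FractionalIdeal.inv_anti_mono hI ht (le_tClosure I)) ?_
  rw [← inv_vClosure I]
  exact FractionalIdeal.inv_anti_mono ht (inv_ne_zero' (inv_ne_zero' hI)) (tClosure_le_vClosure I)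

lemma TInvertible.ideal_inv (I : TInvertible R K) : (I⁻¹).ideal = I.ideal⁻¹ := by
  have h : tClosure (I.ideal * (I⁻¹).ideal) = 1 :=
    congrArg TIdeal.toFractionalIdeal (mul_inv_cancel I |> congrArg Units.val)
  refine le_antisymm (mem_inv_of_mul_le_one I.val.ne_zero ?_) ?_
  · rw [mul_comm, ← h]
    exact le_tClosure _
  · calc I.ideal⁻¹ = tClosure (I.ideal * (I⁻¹).ideal) * I.ideal⁻¹ := by rw [h, one_mul]
      _ ≤ tClosure (I.ideal * (I⁻¹).ideal * I.ideal⁻¹) := tClosure_mul_le _ _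
      _ = tClosure (I.ideal⁻¹ * I.ideal * (I⁻¹).ideal) := by congr 1; ring
      _ ≤ tClosure (1 * (I⁻¹).ideal) := tClosure_mono (mul_le_mul_left (inv_mul_le_one _) _)
      _ = (I⁻¹).ideal := by rw [one_mul]; exact (I⁻¹).val.tClosure_eq

lemma TInvertible.ideal_mul (I J : TInvertible R K) :
    (I * J).ideal = ((I.ideal * J.ideal)⁻¹)⁻¹ := by
  conv_lhs => rw [← inv_inv (I * J), ideal_inv, ideal_inv]
  change (tClosure (I.ideal * J.ideal))⁻¹⁻¹ = _
  rw [inv_tClosure]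

lemma principal_ideal (u : Kˣ) :
    (principal R K u).ideal = FractionalIdeal.spanSingleton R⁰ (u : K) := rfl

variable (R) in
/-- The class group `Cl(R) = T(R) / P(R)`: `t`-invertible fractional `t`-ideals modulo
principal fractional ideals, inside the quotient field of `R`. -/
abbrev Cl : Type _ := TInvertible R (FractionRing R) ⧸ (principal R (FractionRing R)).range

/-- The class `[I] ∈ Cl(R)` of a `t`-invertible fractional `t`-ideal `I`. -/
abbrev Cl.mk : TInvertible R (FractionRing R) →* Cl R := QuotientGroup.mk' _

end ClassGroup

section Homogeneous

variable {ι σ R K : Type*} [CommRing R] [IsDomain R] [Field K] [Algebra R K] [IsFractionRing R K]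
  [DecidableEq ι] [AddCancelCommMonoid ι] [SetLike σ R] [AddSubmonoidClass σ R]
  (𝒜 : ι → σ) [GradedRing 𝒜]

/-- A fractional ideal `I` of the graded domain `R` is homogeneous if `s I` is a homogeneous
integral ideal of `R` for some nonzero homogeneous element `s` of `R`. -/
def IsHomogeneousFractional (I : FractionalIdeal R⁰ K) : Prop :=
  ∃ s : R, s ≠ 0 ∧ SetLike.IsHomogeneousElem 𝒜 s ∧ ∃ J : Ideal R, J.IsHomogeneous 𝒜 ∧
    FractionalIdeal.spanSingleton R⁰ (algebraMap R K s) * I = (J : FractionalIdeal R⁰ K)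

variable {𝒜}

lemma isHomogeneousFractional_one : IsHomogeneousFractional 𝒜 (1 : FractionalIdeal R⁰ K) :=
  ⟨1, one_ne_zero, SetLike.isHomogeneousElem_one 𝒜, ⊤, Ideal.IsHomogeneous.top 𝒜, by simp⟩

lemma IsHomogeneousFractional.mul {I J : FractionalIdeal R⁰ K}
    (hI : IsHomogeneousFractional 𝒜 I) (hJ : IsHomogeneousFractional 𝒜 J) :
    IsHomogeneousFractional 𝒜 (I * J) := by
  obtain ⟨s, hs, hs', I', hI', hI⟩ := hI
  obtain ⟨t, ht, ht', J', hJ', hJ⟩ := hJ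
  refine ⟨s * t, mul_ne_zero hs ht, hs'.mul ht', I' * J', hI'.mul hJ', ?_⟩
  rw [FractionalIdeal.coeIdeal_mul, ← hI, ← hJ, map_mul,
    ← FractionalIdeal.spanSingleton_mul_spanSingleton]
  ring

/-- If `b ≠ 0` is homogeneous and `H` is a homogeneous ideal, then `{r | r H ⊆ b R}` is
homogeneous. -/
lemma isHomogeneous_of_mul_mem {b : R} (hb : SetLike.IsHomogeneousElem 𝒜 b) {H L : Ideal R}
    (hH : H.IsHomogeneous 𝒜) (hL : ∀ r, r ∈ L ↔ ∀ j ∈ H, r * j ∈ Ideal.span {b}) :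
    L.IsHomogeneous 𝒜 := by
  have hbh : (Ideal.span {b}).IsHomogeneous 𝒜 :=
    Ideal.homogeneous_span 𝒜 _ (by simpa using hb)
  intro i r hr
  refine (hL _).2 fun j hj => ?_
  classical
  rw [← DirectSum.sum_support_decompose 𝒜 j, Finset.mul_sum]
  refine Ideal.sum_mem _ fun k _ => ?_
  rw [← DirectSum.coe_decompose_mul_add_of_right_mem 𝒜 (i := i)
    (DirectSum.decompose 𝒜 j k).2]
  exact hbh _ ((hL r).1 hr _ (hH k hj))

lemma IsHomogeneousFractional.inv {I : FractionalIdeal R⁰ K} (hI0 : I ≠ 0)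
    (hI : IsHomogeneousFractional 𝒜 I) : IsHomogeneousFractional 𝒜 I⁻¹ := by
  obtain ⟨s, hs, hs', H, hH, hsI⟩ := hI
  have hsK : algebraMap R K s ≠ 0 := by simpa using hs
  have hmem : ∀ j, j ∈ H ↔ ∃ x ∈ I, algebraMap R K j = algebraMap R K s * x := fun j => by
    rw [← FractionalIdeal.mem_singleton_mul, hsI, FractionalIdeal.mem_coeIdeal]
    exact ⟨fun h => ⟨j, h, rfl⟩, fun ⟨k, hk, h⟩ => IsFractionRing.injective R K h ▸ hk⟩
  have hmem' : ∀ x ∈ I, ∃ j ∈ H, algebraMap R K j = algebraMap R K s * x := fun x hx => by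
    have h1 : algebraMap R K s * x ∈ (H : FractionalIdeal R⁰ K) :=
      hsI ▸ FractionalIdeal.mem_singleton_mul.2 ⟨x, hx, rfl⟩
    simpa [FractionalIdeal.mem_coeIdeal] using h1
  obtain ⟨a, haH, ha0, ha'⟩ : ∃ a ∈ H, a ≠ 0 ∧ SetLike.IsHomogeneousElem 𝒜 a := by
    obtain ⟨x, hx, hx0⟩ := Submodule.exists_mem_ne_zero_of_ne_bot
      (fun h => hI0 (FractionalIdeal.coeToSubmodule_eq_bot.1 h))
    obtain ⟨j, hj, hjx⟩ := hmem' x hx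
    have hj0 : j ≠ 0 := by
      rintro rfl
      rw [map_zero] at hjx
      exact mul_ne_zero hsK hx0 hjx.symm
    by_contra! hcon
    refine hj0 ?_
    classical
    rw [← DirectSum.sum_support_decompose 𝒜 j]
    refine Finset.sum_eq_zero fun i _ => ?_
    by_contra hne
    exact hcon _ (hH i hj) hne ⟨i, (DirectSum.decompose 𝒜 j i).2⟩
  have haK : algebraMap R K a ≠ 0 := by simpa using ha0
  let L : Ideal R :=
    { carrier := {r | ∀ j ∈ H, r * j ∈ Ideal.span {a * s}}
      zero_mem' := fun j _ => by simp
      add_mem' := fun hx hy j hj => by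
        rw [add_mul]
        exact Ideal.add_mem _ (hx j hj) (hy j hj)
      smul_mem' := fun c x hx j hj => by
        rw [smul_eq_mul, mul_assoc]
        exact Ideal.mul_mem_left _ _ (hx j hj) }
  refine ⟨a, ha0, ha', L,
    isHomogeneous_of_mul_mem (ha'.mul hs') hH (fun _ => Iff.rfl), ?_⟩
  ext x
  rw [FractionalIdeal.mem_singleton_mul, FractionalIdeal.mem_coeIdeal]
  constructor
  · rintro ⟨z, hz, rfl⟩
    rw [FractionalIdeal.mem_inv_iff hI0] at hz
    obtain ⟨i, hi, hai⟩ := (hmem a).1 haH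
    obtain ⟨r, hr⟩ := (FractionalIdeal.mem_one_iff _).1 (hz i hi)
    refine ⟨r * s, fun j hj => ?_, ?_⟩
    · obtain ⟨k, hk, hjk⟩ := (hmem j).1 hj
      obtain ⟨c, hc⟩ := (FractionalIdeal.mem_one_iff _).1 (hz k hk)
      refine Ideal.mem_span_singleton'.2 ⟨c, IsFractionRing.injective R K ?_⟩
      simp only [map_mul, hr, hc, hjk, hai]
      ring
    · simp only [map_mul, hr, hai]
      ring
  · rintro ⟨r, hr, rfl⟩
    refine ⟨algebraMap R K r / algebraMap R K a,
      (FractionalIdeal.mem_inv_iff hI0).2 fun y hy => ?_, by field_simp⟩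
    obtain ⟨j, hj, hjy⟩ := hmem' y hy
    obtain ⟨c, hc⟩ := Ideal.mem_span_singleton'.1 (hr j hj)
    refine (FractionalIdeal.mem_one_iff _).2 ⟨c, ?_⟩
    have h2 := congrArg (algebraMap R K) hc
    simp only [map_mul, hjy] at h2
    field_simp
    refine mul_left_cancel₀ hsK ?_
    linear_combination h2

variable (K) in
variable (𝒜) in
/-- `HT(R)`: the group of homogeneous `t`-invertible fractional `t`-ideals of `R`. -/
def HTInvertible : Subgroup (TInvertible R K) where
  carrier := {I | IsHomogeneousFractional 𝒜 I.ideal}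
  one_mem' := isHomogeneousFractional_one
  mul_mem' := by
    intro I J hI hJ
    have h0 : I.ideal * J.ideal ≠ 0 := mul_ne_zero' I.val.ne_zero J.val.ne_zero
    change IsHomogeneousFractional 𝒜 (I * J).ideal
    rw [TInvertible.ideal_mul]
    exact ((hI.mul hJ).inv h0).inv (inv_ne_zero' h0)
  inv_mem' := by
    intro I hI
    change IsHomogeneousFractional 𝒜 (I⁻¹).ideal
    rw [TInvertible.ideal_inv]
    exact hI.inv I.val.ne_zero

variable (𝒜) in
/-- The homogeneous class group `HCl(R) = HT(R) / HP(R)` as a subgroup of `Cl(R)`: the classes of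
the homogeneous `t`-invertible fractional `t`-ideals. -/
def HCl : Subgroup (Cl R) := (HTInvertible (FractionRing R) 𝒜).map Cl.mk

end Homogeneous

section Polynomial

/-- The natural grading of `A[X]`: the degree `n` component is `A Xⁿ`. -/
def polynomialGrading (A : Type*) [CommRing A] (n : ℕ) : Submodule A A[X] :=
  LinearMap.range (Polynomial.monomial n)

/-- The map `a ↦ a Xⁿ` from `A` to the degree `n` component of `A[X]`. -/
def toPolynomialGrading (A : Type*) [CommRing A] (n : ℕ) : A →ₗ[A] polynomialGrading A n :=
  (Polynomial.monomial n).codRestrict _ fun a => ⟨a, rfl⟩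

instance (A : Type*) [CommRing A] : GradedAlgebra (polynomialGrading A) where
  one_mem := ⟨1, rfl⟩
  mul_mem := by
    rintro i j _ _ ⟨a, rfl⟩ ⟨b, rfl⟩
    exact ⟨a * b, (Polynomial.monomial_mul_monomial i j a b).symm⟩
  toDecomposition := DirectSum.Decomposition.ofLinearMap _
    (Polynomial.lsum fun n => (DirectSum.lof A ℕ (fun n => polynomialGrading A n) n).comp
      (toPolynomialGrading A n))
    (by
      ext n : 2
      simp only [LinearMap.comp_apply, LinearMap.id_apply]
      rw [Polynomial.lsum_apply, Polynomial.sum_monomial_index _ _ (by simp)]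
      rw [LinearMap.comp_apply, DirectSum.coeLinearMap_lof]
      rfl)
    (by
      ext n x : 2
      obtain ⟨_, a, rfl⟩ := x
      simp only [LinearMap.comp_apply, LinearMap.id_apply, DirectSum.coeLinearMap_lof]
      rw [Polynomial.lsum_apply, Polynomial.sum_monomial_index _ _ (by simp)]
      rfl)

end Polynomial

end TClass

end

/-! Inside the quotient field of `A[X]`, a fractional ideal J of A extends to J[X], the polynomials
over K with all coefficients in J (`mem_extendedHom`). Arguing coefficient by coefficient, extension
commutes with inverses, hence with v-closures. Since finitely many elements of J[X] involve only
finitely many elements of J, it also commutes with t-closures (`extendedHom_tClosure`). So J ↦ J[X]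
is a homomorphism T(A) → T(A[X]). It is injective on classes because a generator of a principal J[X]
divides a nonzero constant in K[X], hence is constant.

The image is controlled by one criterion, `exists_extend_of_coeff_mul_mem`. If u⁻¹I and uI⁻¹ consist
of polynomials over K, and coefficients of the former times coefficients of the latter lie in A,
then I⁻¹ = u⁻¹J⁻¹[X], where J is spanned by the coefficients of u⁻¹I; hence the class of I comes
from A. For a homogeneous integral ideal u is a power of X, and the coefficient condition holds
because each monomial of an element is again in the ideal. For A integrally closed, u comes from a
generator of an ideal of the principal ideal domain K[X], and the coefficient condition is Gauss's
lemma, proved one valuation ring at a time.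

If A is not integrally closed, take u in K outside A with f(u) = 0, f monic over A, and write f = (X
- u)g. The ideal W = (b, g), where b ≠ 0 clears the denominator of X - u, is t-invertible because
WW⁻¹ contains a nonzero constant and the monic f. If W_t were a multiple of some J[X], the monicity
of g would force 1 ∈ W_t; as X - u ∈ W⁻¹, this gives u ∈ A. -/

noncomputable section

namespace TClass

open Polynomial

/-! ### Extension of fractional ideals from A to A[X] -/

section PolynomialExtension

variable (A K L : Type*) [CommRing A] [IsDomain A] [Field K] [Algebra A K] [IsFractionRing A K]
  [Field L] [Algebra A[X] L] [IsFractionRing A[X] L]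

/-- The canonical map from the quotient field of `A` to the quotient field of `A[X]`. -/
def fractionMap : K →+* L :=
  IsLocalization.map (S := K) L (algebraMap A A[X])
    (nonZeroDivisors_le_comap_nonZeroDivisors_of_injective _
      (FaithfulSMul.algebraMap_injective A A[X]))

@[simp] lemma fractionMap_algebraMap (a : A) :
    fractionMap A K L (algebraMap A K a) = algebraMap A[X] L (C a) := by
  rw [fractionMap, IsLocalization.map_eq]; rfl

/-- The canonical map from `K[X]` to the quotient field of `A[X]`. -/
def polynomialMap : K[X] →+* L :=
  eval₂RingHom (fractionMap A K L) (algebraMap A[X] L X)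

@[simp] lemma polynomialMap_C (c : K) : polynomialMap A K L (C c) = fractionMap A K L c := by
  simp [polynomialMap]

@[simp] lemma polynomialMap_X : polynomialMap A K L X = algebraMap A[X] L X := by
  simp [polynomialMap]

@[simp] lemma polynomialMap_map (p : A[X]) :
    polynomialMap A K L (p.map (algebraMap A K)) = algebraMap A[X] L p := by
  have : (polynomialMap A K L).comp (mapRingHom (algebraMap A K)) = algebraMap A[X] L := by
    apply Polynomial.ringHom_ext <;> simp
  exact congr($this p)

lemma exists_C_mul_eq_map (p : K[X]) : ∃ (b : A) (q : A[X]), b ≠ 0 ∧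
    C (algebraMap A K b) * p = q.map (algebraMap A K) := by
  obtain ⟨b, hb0, hb⟩ := IsLocalization.integerNormalization_spec A⁰ p
  refine ⟨b, IsLocalization.integerNormalization A⁰ p, nonZeroDivisors.ne_zero hb0, ?_⟩
  rw [hb, Algebra.smul_def]
  rfl

lemma polynomialMap_injective : Function.Injective (polynomialMap A K L) := by
  refine (injective_iff_map_eq_zero _).2 fun p hp => ?_
  obtain ⟨b, q, hb, hq⟩ := exists_C_mul_eq_map A K p
  have h1 := congrArg (polynomialMap A K L) hq
  rw [map_mul, hp, mul_zero, polynomialMap_map, eq_comm,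
    map_eq_zero_iff _ (IsFractionRing.injective A[X] L)] at h1
  rw [h1, Polynomial.map_zero, mul_eq_zero, C_eq_zero] at hq
  exact hq.resolve_left (by simpa using hb)

variable {A K L}

/-- The usual way to show that an element of L is a polynomial over K: multiply it by a nonzero
constant so that it lands in `A[X]`. -/
lemma exists_polynomialMap_eq {c : K} (hc : c ≠ 0) {x : L} {q : K[X]}
    (h : polynomialMap A K L q = fractionMap A K L c * x) : ∃ p, polynomialMap A K L p = x := by
  refine ⟨C c⁻¹ * q, ?_⟩
  rw [map_mul, h, polynomialMap_C, map_inv₀, inv_mul_cancel_left₀]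
  simpa using hc

/-- Such polynomials form an `A[X]`-module containing J, and each is an `A[X]`-combination of its
own coefficients. This reduces later questions to coefficients. -/
lemma mem_extendedHom {J : FractionalIdeal A⁰ K} {x : L} :
    x ∈ FractionalIdeal.extendedHom L A[X] J ↔
      ∃ p : K[X], (∀ n, p.coeff n ∈ J) ∧ polynomialMap A K L p = x := by
  rw [FractionalIdeal.extendedHom'_apply, FractionalIdeal.mem_extended_iff]
  constructor
  · intro hx
    induction hx using Submodule.span_induction with
    | mem x hx =>
      obtain ⟨k, hk, rfl⟩ := hx
      refine ⟨C k, fun n => ?_, by simp [fractionMap]⟩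
      rw [coeff_C]
      split_ifs
      exacts [hk, Submodule.zero_mem (J : Submodule A K)]
    | zero => exact ⟨0, fun n => Submodule.zero_mem (J : Submodule A K), by simp⟩
    | add x y _ _ hx hy =>
      obtain ⟨p, hp, rfl⟩ := hx
      obtain ⟨q, hq, rfl⟩ := hy
      exact ⟨p + q, fun n => by
        rw [coeff_add]; exact Submodule.add_mem (J : Submodule A K) (hp n) (hq n), by simp⟩
    | smul r x _ hx =>
      obtain ⟨p, hp, rfl⟩ := hx
      refine ⟨r.map (algebraMap A K) * p, fun n => ?_, by simp [Algebra.smul_def]⟩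
      rw [coeff_mul]
      refine Submodule.sum_mem (J : Submodule A K) fun i _ => ?_
      rw [coeff_map, ← Algebra.smul_def]
      exact Submodule.smul_mem (J : Submodule A K) _ (hp _)
  · rintro ⟨p, hp, rfl⟩
    rw [p.as_sum_range_C_mul_X_pow, map_sum]
    refine Submodule.sum_mem _ fun i _ => ?_
    rw [map_mul, polynomialMap_C, map_pow, polynomialMap_X, mul_comm, ← map_pow,
      ← Algebra.smul_def]
    exact Submodule.smul_mem _ _ (Submodule.subset_span ⟨_, hp i, rfl⟩)

lemma polynomialMap_mem_extendedHom {J : FractionalIdeal A⁰ K} {p : K[X]} :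
    polynomialMap A K L p ∈ FractionalIdeal.extendedHom L A[X] J ↔ ∀ n, p.coeff n ∈ J := by
  rw [mem_extendedHom]
  constructor
  · rintro ⟨q, hq, h⟩
    rwa [← polynomialMap_injective A K L h]
  · exact fun h => ⟨p, h, rfl⟩

lemma fractionMap_mem_extendedHom {J : FractionalIdeal A⁰ K} {c : K} :
    fractionMap A K L c ∈ FractionalIdeal.extendedHom L A[X] J ↔ c ∈ J := by
  rw [← polynomialMap_C, polynomialMap_mem_extendedHom]
  constructor
  · intro h
    simpa using h 0
  · intro h n
    rw [coeff_C]
    split_ifs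
    exacts [h, Submodule.zero_mem (J : Submodule A K)]

lemma polynomialMap_mem_one {p : K[X]} :
    polynomialMap A K L p ∈ (1 : FractionalIdeal A[X]⁰ L) ↔
      ∀ n, p.coeff n ∈ (1 : FractionalIdeal A⁰ K) := by
  rw [← polynomialMap_mem_extendedHom (L := L), map_one]

lemma exists_polynomialMap_of_mem_one {x : L} (hx : x ∈ (1 : FractionalIdeal A[X]⁰ L)) :
    ∃ p, polynomialMap A K L p = x := by
  obtain ⟨b, rfl⟩ := (FractionalIdeal.mem_one_iff _).1 hx
  exact ⟨_, polynomialMap_map A K L b⟩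

lemma extendedHom_le_extendedHom {I J : FractionalIdeal A⁰ K} :
    FractionalIdeal.extendedHom L A[X] I ≤ FractionalIdeal.extendedHom L A[X] J ↔ I ≤ J := by
  constructor
  · exact fun h x hx => fractionMap_mem_extendedHom.1 (h (fractionMap_mem_extendedHom.2 hx))
  · intro h x hx
    obtain ⟨p, hp, rfl⟩ := mem_extendedHom.1 hx
    exact polynomialMap_mem_extendedHom.2 fun n => h (hp n)

variable (A K L) in
lemma extendedHom_injective : Function.Injective
    (FractionalIdeal.extendedHom L A[X] : FractionalIdeal A⁰ K →+* FractionalIdeal A[X]⁰ L) :=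
  fun _ _ h => le_antisymm (extendedHom_le_extendedHom.1 h.le) (extendedHom_le_extendedHom.1 h.ge)

lemma exists_mem_ne_zero {R F : Type*} [CommRing R] [IsDomain R] [Field F] [Algebra R F]
    [IsFractionRing R F] {I : FractionalIdeal R⁰ F} (hI : I ≠ 0) : ∃ x ∈ I, x ≠ 0 :=
  Submodule.exists_mem_ne_zero_of_ne_bot
    (fun h => hI (FractionalIdeal.coeToSubmodule_eq_bot.1 h))

lemma extendedHom_ne_zero {J : FractionalIdeal A⁰ K} (hJ : J ≠ 0) :
    FractionalIdeal.extendedHom L A[X] J ≠ 0 :=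
  (FractionalIdeal.extendedHom_eq_zero_iff _ _).not.2 hJ

/-- If x multiplies J[X] into `A[X]`, then jx ∈ `A[X]` for one nonzero j ∈ J makes x a polynomial
over K, and cx ∈ `A[X]` for every c ∈ J puts each of its coefficients in J⁻¹. No finiteness of J is
needed. -/
lemma extendedHom_inv (J : FractionalIdeal A⁰ K) :
    FractionalIdeal.extendedHom L A[X] J⁻¹ = (FractionalIdeal.extendedHom L A[X] J)⁻¹ := by
  rcases eq_or_ne J 0 with rfl | hJ
  · simp [FractionalIdeal.inv_zero']
  refine le_antisymm (mem_inv_of_mul_le_one (extendedHom_ne_zero hJ) ?_) fun x hx => ?_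
  · rw [← map_mul, ← map_one (FractionalIdeal.extendedHom (A := A) (K := K) L A[X]),
      extendedHom_le_extendedHom]
    exact inv_mul_le_one J
  · rw [FractionalIdeal.mem_inv_iff (extendedHom_ne_zero hJ)] at hx
    have hx' : ∀ c ∈ J, fractionMap A K L c * x ∈ (1 : FractionalIdeal A[X]⁰ L) := fun c hc => by
      rw [mul_comm]
      exact hx _ (fractionMap_mem_extendedHom.2 hc)
    obtain ⟨j, hj, hj0⟩ := exists_mem_ne_zero (R := A) hJ
    obtain ⟨q, hq⟩ := exists_polynomialMap_of_mem_one (A := A) (K := K) (hx' j hj)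
    obtain ⟨p, rfl⟩ := exists_polynomialMap_eq hj0 hq
    refine polynomialMap_mem_extendedHom.2 fun n => (FractionalIdeal.mem_inv_iff hJ).2 fun c hc => ?_
    have h1 := hx' c hc
    rw [← polynomialMap_C, ← map_mul, polynomialMap_mem_one] at h1
    simpa [mul_comm] using h1 n

lemma extendedHom_vClosure (J : FractionalIdeal A⁰ K) :
    FractionalIdeal.extendedHom L A[X] (vClosure J) =
      vClosure (FractionalIdeal.extendedHom L A[X] J) := by
  rw [vClosure, vClosure, extendedHom_inv, extendedHom_inv]

lemma extendedHom_fg {J : FractionalIdeal A⁰ K} (hJ : (J : Submodule A K).FG) :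
    (FractionalIdeal.extendedHom L A[X] J : Submodule A[X] L).FG := by
  obtain ⟨s, hs⟩ := hJ
  classical
  refine ⟨s.image (fractionMap A K L), le_antisymm ?_ ?_⟩
  · rw [Submodule.span_le]
    intro x hx
    obtain ⟨c, hc, rfl⟩ := Finset.mem_image.1 (Finset.mem_coe.1 hx)
    refine fractionMap_mem_extendedHom.2 ?_
    rw [← FractionalIdeal.mem_coe, ← hs]
    exact Submodule.subset_span hc
  · rw [FractionalIdeal.extendedHom'_apply, FractionalIdeal.coe_extended_eq_span,
      Submodule.span_le]
    rintro _ ⟨c, hc, rfl⟩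
    rw [SetLike.mem_coe, ← FractionalIdeal.mem_coe, ← hs] at hc
    change fractionMap A K L c ∈ Submodule.span A[X] _
    induction hc using Submodule.span_induction with
    | mem x hx => exact Submodule.subset_span (Finset.mem_coe.2 (Finset.mem_image_of_mem _ hx))
    | zero => simp
    | add x y _ _ hx hy => rw [map_add]; exact Submodule.add_mem _ hx hy
    | smul a x _ hx =>
      rw [Algebra.smul_def, map_mul, fractionMap_algebraMap, ← Algebra.smul_def]
      exact Submodule.smul_mem _ _ hx

lemma exists_fg_le_of_mem_extendedHom (J : FractionalIdeal A⁰ K) {x : L}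
    (hx : x ∈ FractionalIdeal.extendedHom L A[X] J) :
    ∃ F : FractionalIdeal A⁰ K, (F : Submodule A K).FG ∧ F ≤ J ∧
      x ∈ FractionalIdeal.extendedHom L A[X] F := by
  obtain ⟨p, hp, rfl⟩ := mem_extendedHom.1 hx
  have hle : Submodule.span A (p.coeffs : Set K) ≤ (J : Submodule A K) := by
    rw [Submodule.span_le]
    intro c hc
    obtain ⟨n, -, rfl⟩ := mem_coeffs_iff.1 (Finset.mem_coe.1 hc)
    exact hp n
  refine ⟨⟨_, FractionalIdeal.isFractional_of_le hle⟩, ⟨_, rfl⟩, hle,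
    polynomialMap_mem_extendedHom.2 fun n => ?_⟩
  change p.coeff n ∈ Submodule.span A (p.coeffs : Set K)
  -- The finite set `coeffs` records only the nonzero coefficients.
  by_cases h : p.coeff n = 0
  · simp [h]
  · exact Submodule.subset_span (coeff_mem_coeffs h)

lemma exists_fg_le_of_le_extendedHom (J : FractionalIdeal A⁰ K) (N : Submodule A[X] L)
    (hN : N.FG) (h : N ≤ (FractionalIdeal.extendedHom L A[X] J : Submodule A[X] L)) :
    ∃ F : FractionalIdeal A⁰ K, (F : Submodule A K).FG ∧ F ≤ J ∧
      N ≤ (FractionalIdeal.extendedHom L A[X] F : Submodule A[X] L) := by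
  induction N, hN using Submodule.fg_induction with
  | singleton x =>
    obtain ⟨F, hF, hFJ, hx⟩ :=
      exists_fg_le_of_mem_extendedHom J (h (Submodule.mem_span_singleton_self x))
    exact ⟨F, hF, hFJ, (Submodule.span_singleton_le_iff_mem _ _).2 hx⟩
  | sup N₁ N₂ _ _ h₁ h₂ =>
    obtain ⟨F, hF, hFJ, hx⟩ := h₁ (le_sup_left.trans h)
    obtain ⟨G, hG, hGJ, hy⟩ := h₂ (le_sup_right.trans h)
    refine ⟨F ⊔ G, ?_, sup_le hFJ hGJ, sup_le (hx.trans ?_) (hy.trans ?_)⟩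
    · rw [FractionalIdeal.coe_sup]
      exact hF.sup hG
    · exact extendedHom_le_extendedHom.2 le_sup_left
    · exact extendedHom_le_extendedHom.2 le_sup_right

/-- Both inclusions reduce to `extendedHom_vClosure` for a finitely generated G ≤ J: the finitely
many coefficients of an element of J_t[X] lie in a single G_v, and a finitely generated F ≤ J[X]
lies in a single G[X]. -/
lemma extendedHom_tClosure (J : FractionalIdeal A⁰ K) :
    FractionalIdeal.extendedHom L A[X] (tClosure J) =
      tClosure (FractionalIdeal.extendedHom L A[X] J) := by
  refine le_antisymm (fun x hx => ?_) fun x hx => ?_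
  · obtain ⟨F, hF, hFJ, hx⟩ := exists_fg_le_of_mem_extendedHom _ hx
    obtain ⟨G, hG, hGJ, hFG⟩ := exists_fg_of_le_tClosure (F : Submodule A K) hF hFJ
    refine mem_tClosure.2 ⟨FractionalIdeal.extendedHom L A[X] G, extendedHom_fg hG,
      extendedHom_le_extendedHom.2 hGJ, ?_⟩
    rw [← extendedHom_vClosure]
    exact extendedHom_le_extendedHom.2 hFG hx
  · obtain ⟨F, hF, hFJ, hx⟩ := mem_tClosure.1 hx
    obtain ⟨G, hG, hGJ, hFG⟩ := exists_fg_le_of_le_extendedHom J (F : Submodule A[X] L) hF hFJ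
    have h1 : x ∈ vClosure (FractionalIdeal.extendedHom L A[X] G) := vClosure_mono hFG hx
    rw [← extendedHom_vClosure] at h1
    exact extendedHom_le_extendedHom.2
      (fun y hy => mem_tClosure.2 ⟨G, hG, hGJ, hy⟩) h1

variable (A K L) in
/-- Extension of `t`-ideals from `A` to `A[X]`. -/
def TIdeal.extend : TIdeal A K →* TIdeal A[X] L where
  toFun J :=
    { toFractionalIdeal := FractionalIdeal.extendedHom L A[X] J.toFractionalIdeal
      ne_zero := extendedHom_ne_zero J.ne_zero
      tClosure_eq := by rw [← extendedHom_tClosure, J.tClosure_eq] }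
  map_one' := TIdeal.ext (map_one (FractionalIdeal.extendedHom (A := A) (K := K) L A[X]))
  map_mul' I J := TIdeal.ext <| by
    change FractionalIdeal.extendedHom L A[X] (tClosure _) = tClosure (_ * _)
    rw [extendedHom_tClosure, map_mul]

variable (A K L) in
/-- Extension of `t`-invertible `t`-ideals from `A` to `A[X]`. -/
def TInvertible.extend : TInvertible A K →* TInvertible A[X] L := Units.map (TIdeal.extend A K L)

lemma TInvertible.extend_ideal (J : TInvertible A K) : (extend A K L J).ideal =
    FractionalIdeal.extendedHom L A[X] J.ideal := rfl

lemma TInvertible.ideal_injective {R F : Type*} [CommRing R] [IsDomain R] [Field F] [Algebra R F]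
    [IsFractionRing R F] : Function.Injective (TInvertible.ideal : TInvertible R F → _) :=
  fun _ _ h => Units.ext (TIdeal.ext h)

lemma extend_principal (u : Kˣ) : TInvertible.extend A K L (principal A K u) =
    principal A[X] L (Units.map (fractionMap A K L : K →* L) u) :=
  TInvertible.ideal_injective (FractionalIdeal.extended_spanSingleton L _ (u : K))

end PolynomialExtension

/-! ### Recognizing multiples of extended ideals -/

section Descent

variable {R F : Type*} [CommRing R] [IsDomain R] [Field F] [Algebra R F] [IsFractionRing R F]

lemma tClosure_ne_zero {I : FractionalIdeal R⁰ F} (hI : I ≠ 0) : tClosure I ≠ 0 := fun h =>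
  hI (le_antisymm ((le_tClosure I).trans h.le) (FractionalIdeal.zero_le _))

lemma ne_zero_of_tClosure_eq_one {I : FractionalIdeal R⁰ F} (h : tClosure I = 1) : I ≠ 0 := by
  rintro rfl
  rw [← FractionalIdeal.spanSingleton_zero, tClosure_spanSingleton,
    FractionalIdeal.spanSingleton_zero] at h
  exact zero_ne_one h

/-- The `t`-closure of `I` as an element of `T(R)`, if `(I J)_t = R` for some `J`. -/
def TInvertible.ofMul (I J : FractionalIdeal R⁰ F) (h : tClosure (I * J) = 1) :
    TInvertible R F where
  val := ⟨tClosure I, tClosure_ne_zero fun hI => ne_zero_of_tClosure_eq_one h (by simp [hI]),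
    tClosure_tClosure I⟩
  inv := ⟨tClosure J, tClosure_ne_zero fun hJ => ne_zero_of_tClosure_eq_one h (by simp [hJ]),
    tClosure_tClosure J⟩
  val_inv := TIdeal.ext <| by
    change tClosure (tClosure I * tClosure J) = 1
    rw [tClosure_tClosure_mul, mul_comm, tClosure_tClosure_mul, mul_comm, h]
  inv_val := TIdeal.ext <| by
    change tClosure (tClosure J * tClosure I) = 1
    rw [tClosure_tClosure_mul, mul_comm, tClosure_tClosure_mul, h]

lemma TInvertible.ofMul_ideal (I J : FractionalIdeal R⁰ F) (h : tClosure (I * J) = 1) :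
    (ofMul I J h).ideal = tClosure I := rfl

lemma TInvertible.tClosure_ideal_mul_inv (I : TInvertible R F) :
    tClosure (I.ideal * I.ideal⁻¹) = 1 := by
  rw [← ideal_inv]
  exact congrArg TIdeal.toFractionalIdeal (mul_inv_cancel I |> congrArg Units.val)

/-- One inclusion holds for every scalar; the other is the same inclusion for u⁻¹ and uI, multiplied
by u. -/
lemma tClosure_spanSingleton_mul {u : F} (hu : u ≠ 0) (I : FractionalIdeal R⁰ F) :
    tClosure (FractionalIdeal.spanSingleton R⁰ u * I) =
      FractionalIdeal.spanSingleton R⁰ u * tClosure I := by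
  have key (v : F) (J : FractionalIdeal R⁰ F) : FractionalIdeal.spanSingleton R⁰ v * tClosure J ≤
      tClosure (FractionalIdeal.spanSingleton R⁰ v * J) := by
    rw [mul_comm, mul_comm _ J]
    exact tClosure_mul_le _ _
  refine le_antisymm ?_ (key u I)
  have h := mul_le_mul_right (key u⁻¹ (FractionalIdeal.spanSingleton R⁰ u * I))
    (FractionalIdeal.spanSingleton R⁰ u)
  simpa [← mul_assoc, FractionalIdeal.spanSingleton_mul_spanSingleton, hu] using h

lemma TInvertible.principal_mul_ideal (u : Fˣ) (I : TInvertible R F) :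
    (principal R F u * I).ideal = FractionalIdeal.spanSingleton R⁰ (u : F) * I.ideal := by
  change tClosure (FractionalIdeal.spanSingleton R⁰ (u : F) * I.ideal) = _
  rw [tClosure_spanSingleton_mul u.ne_zero]
  exact congrArg _ I.val.tClosure_eq

variable {A K L : Type*} [CommRing A] [IsDomain A] [Field K] [Algebra A K] [IsFractionRing A K]
  [Field L] [Algebra A[X] L] [IsFractionRing A[X] L]

/-- A `t`-invertible `t`-ideal of `A[X]` that is a multiple of an extended ideal is a multiple of
an extended `t`-invertible `t`-ideal. -/
lemma exists_extend_of_ideal_eq (I : TInvertible A[X] L) (u : Lˣ) (J : FractionalIdeal A⁰ K)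
    (h : I.ideal = FractionalIdeal.spanSingleton A[X]⁰ (u : L) *
      FractionalIdeal.extendedHom L A[X] J) :
    ∃ J' : TInvertible A K, I = principal A[X] L u * TInvertible.extend A K L J' := by
  have h1 : (principal A[X] L u⁻¹ * I).ideal = FractionalIdeal.extendedHom L A[X] J := by
    rw [TInvertible.principal_mul_ideal, h, ← mul_assoc,
      FractionalIdeal.spanSingleton_mul_spanSingleton]
    simp
  have h2 := (principal A[X] L u⁻¹ * I).tClosure_ideal_mul_inv
  -- Invertibility of J[X] now says that the extensions of (JJ⁻¹)_t and of A agree, so injectivity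
  -- of extension makes J itself t-invertible.
  rw [h1, ← extendedHom_inv, ← map_mul, ← extendedHom_tClosure,
    ← map_one (FractionalIdeal.extendedHom (A := A) (K := K) L A[X])] at h2
  have h3 : (principal A[X] L u⁻¹ * I) =
      TInvertible.extend A K L (TInvertible.ofMul J J⁻¹ (extendedHom_injective A K L h2)) := by
    refine TInvertible.ideal_injective ?_
    rw [TInvertible.extend_ideal, TInvertible.ofMul_ideal, extendedHom_tClosure, ← h1]
    exact (principal A[X] L u⁻¹ * I).val.tClosure_eq.symm
  exact ⟨_, by rw [← h3, ← mul_assoc, ← map_mul]; simp⟩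

/-- If `I ⊆ u K[X]`, `I⁻¹ ⊆ u⁻¹ K[X]`, and products of coefficients of elements of `u⁻¹ I` and of
`u I⁻¹` lie in `A`, then `I` is a multiple of an extended `t`-invertible `t`-ideal. -/
lemma exists_extend_of_coeff_mul_mem (I : TInvertible A[X] L) (u : Lˣ)
    (hI : ∀ y ∈ I.ideal, ∃ p, u * polynomialMap A K L p = y)
    (hI' : ∀ z ∈ I.ideal⁻¹, ∃ q, polynomialMap A K L q = u * z)
    (h : ∀ p q, u * polynomialMap A K L p ∈ I.ideal → ∀ z ∈ I.ideal⁻¹,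
      polynomialMap A K L q = u * z → ∀ n m,
        p.coeff n * q.coeff m ∈ (1 : FractionalIdeal A⁰ K)) :
    ∃ (w : Lˣ) (J : TInvertible A K), I = principal A[X] L w * TInvertible.extend A K L J := by
  have hI0 : I.ideal ≠ 0 := I.val.ne_zero
  let S : Submodule A K :=
    Submodule.span A {c | ∃ p n, u * polynomialMap A K L p ∈ I.ideal ∧ p.coeff n = c}
  have hS : ∀ c ∈ S, ∀ z ∈ I.ideal⁻¹, ∀ q, polynomialMap A K L q = u * z →
      ∀ m, c * q.coeff m ∈ (1 : FractionalIdeal A⁰ K) := by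
    intro c hc z hz q hq m
    induction hc using Submodule.span_induction with
    | mem x hx =>
      obtain ⟨p, n, hp, rfl⟩ := hx
      exact h p q hp z hz hq n m
    | zero => rw [zero_mul]; exact Submodule.zero_mem ((1 : FractionalIdeal A⁰ K) : Submodule A K)
    | add x y _ _ hx hy =>
      rw [add_mul]; exact Submodule.add_mem ((1 : FractionalIdeal A⁰ K) : Submodule A K) hx hy
    | smul a x _ hx =>
      rw [smul_mul_assoc]
      exact Submodule.smul_mem ((1 : FractionalIdeal A⁰ K) : Submodule A K) a hx
  obtain ⟨z, hz, hz0⟩ := exists_mem_ne_zero (inv_ne_zero' hI0)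
  obtain ⟨q, hq⟩ := hI' z hz
  obtain ⟨m, hm⟩ : ∃ m, q.coeff m ≠ 0 := by
    by_contra! hcon
    have : q = 0 := Polynomial.ext (by simpa using hcon)
    rw [this, map_zero] at hq
    exact mul_ne_zero u.ne_zero hz0 hq.symm
  -- One nonzero coefficient of one element of uI⁻¹ serves as a common denominator for S.
  have hSle : S ≤ (FractionalIdeal.spanSingleton A⁰ (q.coeff m)⁻¹ : Submodule A K) := by
    intro c hc
    obtain ⟨a, ha⟩ := (FractionalIdeal.mem_one_iff _).1 (hS c hc z hz q hq m)
    refine (FractionalIdeal.mem_spanSingleton _).2 ⟨a, ?_⟩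
    rw [Algebra.smul_def, ha, mul_inv_cancel_right₀ hm]
  let J : FractionalIdeal A⁰ K := ⟨S, FractionalIdeal.isFractional_of_le hSle⟩
  have hIJ : ∀ y ∈ I.ideal, ∃ x ∈ FractionalIdeal.extendedHom L A[X] J, u * x = y := by
    intro y hy
    obtain ⟨p, rfl⟩ := hI y hy
    exact ⟨_, polynomialMap_mem_extendedHom.2 fun n => Submodule.subset_span ⟨p, n, hy, rfl⟩, rfl⟩
  have hJ0 : J ≠ 0 := by
    intro hJ
    obtain ⟨y, hy, hy0⟩ := exists_mem_ne_zero hI0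
    obtain ⟨x, hx, rfl⟩ := hIJ y hy
    rw [hJ, map_zero, FractionalIdeal.mem_zero_iff] at hx
    simp [hx] at hy0
  -- The argument passes to inverses: I is only known to lie inside uJ[X], but that inclusion and
  -- the coefficient condition together determine I⁻¹ exactly.
  have hinv : (I⁻¹).ideal = FractionalIdeal.spanSingleton A[X]⁰ ((u⁻¹ : Lˣ) : L) *
      FractionalIdeal.extendedHom L A[X] J⁻¹ := by
    rw [TInvertible.ideal_inv]
    ext z
    rw [FractionalIdeal.mem_singleton_mul]
    constructor
    · intro hz
      obtain ⟨q, hq⟩ := hI' z hz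
      refine ⟨polynomialMap A K L q, polynomialMap_mem_extendedHom.2 fun n =>
        (FractionalIdeal.mem_inv_iff hJ0).2 fun c hc => ?_, by simp [hq]⟩
      rw [mul_comm]
      exact hS c hc z hz q hq n
    · rintro ⟨x, hx, rfl⟩
      rw [extendedHom_inv, FractionalIdeal.mem_inv_iff (extendedHom_ne_zero hJ0)] at hx
      refine (FractionalIdeal.mem_inv_iff hI0).2 fun y hy => ?_
      obtain ⟨w, hw, rfl⟩ := hIJ y hy
      convert hx w hw using 1
      simp [mul_left_comm, mul_assoc]
  obtain ⟨J', hJ'⟩ := exists_extend_of_ideal_eq I⁻¹ u⁻¹ J⁻¹ hinv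
  refine ⟨u, J'⁻¹, ?_⟩
  rw [← inv_inv I, hJ', mul_inv, map_inv, map_inv, inv_inv]

end Descent

/-! ### Homogeneous ideals of A[X] -/

section Homogeneous

variable {A K L : Type*} [CommRing A] [IsDomain A] [Field K] [Algebra A K] [IsFractionRing A K]
  [Field L] [Algebra A[X] L] [IsFractionRing A[X] L]

lemma isHomogeneousElem_polynomialGrading_monomial (n : ℕ) (a : A) :
    SetLike.IsHomogeneousElem (polynomialGrading A) (monomial n a) := ⟨n, a, rfl⟩

lemma decompose_polynomialGrading (p : A[X]) (n : ℕ) :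
    (DirectSum.decompose (polynomialGrading A) p n : A[X]) = monomial n (p.coeff n) := by
  induction p using Polynomial.induction_on' with
  | add p q hp hq => simp [DirectSum.decompose_add, hp, hq]
  | monomial m a =>
    have hm : monomial m a ∈ polynomialGrading A m := ⟨a, rfl⟩
    rcases eq_or_ne m n with rfl | hmn
    · rw [DirectSum.decompose_of_mem_same _ hm, coeff_monomial_same]
    · rw [DirectSum.decompose_of_mem_ne _ hm hmn, coeff_monomial_of_ne _ hmn.symm, map_zero]

/-- A denominator a ∈ A of J is homogeneous of degree 0, and aJ[X] is generated by constants. -/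
lemma isHomogeneousFractional_extendedHom (J : FractionalIdeal A⁰ K) :
    IsHomogeneousFractional (polynomialGrading A) (FractionalIdeal.extendedHom L A[X] J) := by
  obtain ⟨a, I, ha, rfl⟩ := FractionalIdeal.exists_eq_spanSingleton_mul J
  have haK : algebraMap A K a ≠ 0 := by simpa using ha
  refine ⟨C a, by simpa using ha, isHomogeneousElem_polynomialGrading_monomial 0 a,
    I.map (algebraMap A A[X]), ?_, ?_⟩
  · refine Ideal.homogeneous_span _ _ ?_
    rintro _ ⟨c, -, rfl⟩
    exact isHomogeneousElem_polynomialGrading_monomial 0 c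
  · rw [← FractionalIdeal.extendedHom_coeIdeal_eq_map (A := A) (K := K) L A[X] I,
      ← fractionMap_algebraMap A K L]
    have := FractionalIdeal.extendedHom_spanSingleton (A := A) L A[X] (algebraMap A K a)
    change _ = FractionalIdeal.spanSingleton A[X]⁰ (fractionMap A K L _) at this
    rw [← this, ← map_mul, ← mul_assoc, FractionalIdeal.spanSingleton_mul_spanSingleton,
      mul_inv_cancel₀ haK, FractionalIdeal.spanSingleton_one, one_mul]

/-- The criterion applies with u = X^m, where m is the least degree occurring in H. Every element of
H is divisible by X^m, and some aX^m with a ≠ 0 lies in H, so X^m z is a polynomial over K for every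
z ∈ I⁻¹. -/
lemma exists_extend_of_homogeneous_ideal (I : TInvertible A[X] L) (H : Ideal A[X])
    (hH : H.IsHomogeneous (polynomialGrading A)) (hIH : I.ideal = (H : FractionalIdeal A[X]⁰ L)) :
    ∃ (w : Lˣ) (J : TInvertible A K), I = principal A[X] L w * TInvertible.extend A K L J := by
  have hmono : ∀ p ∈ H, ∀ n, monomial n (p.coeff n) ∈ H := fun p hp n => by
    rw [← decompose_polynomialGrading]
    exact hH n hp
  have hex : ∃ m, ∃ p ∈ H, p.coeff m ≠ 0 := by
    obtain ⟨y, hy, hy0⟩ := exists_mem_ne_zero I.val.ne_zero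
    change y ∈ I.ideal at hy
    rw [hIH] at hy
    obtain ⟨p, hp, rfl⟩ := (FractionalIdeal.mem_coeIdeal _).1 hy
    by_contra! hcon
    have : p = 0 := Polynomial.ext fun n => by simpa using hcon n p hp
    simp [this] at hy0
  classical
  obtain ⟨p₀, hp₀, ha⟩ := Nat.find_spec hex
  have hmin : ∀ k < Nat.find hex, ∀ p ∈ H, p.coeff k = 0 := fun k hk p hp => by
    by_contra hne
    exact Nat.find_min hex hk ⟨p, hp, hne⟩
  generalize Nat.find hex = m at *
  have hX : algebraMap A[X] L X ≠ 0 := by simp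
  let u : Lˣ := Units.mk0 _ (pow_ne_zero m hX)
  have hu : ∀ p, (u : L) * polynomialMap A K L p = polynomialMap A K L (X ^ m * p) := fun p => by
    simp [u]
  have hmon : ∀ p ∈ H, ∀ n, ∀ z ∈ I.ideal⁻¹,
      algebraMap A[X] L (monomial n (p.coeff n)) * z ∈ (1 : FractionalIdeal A[X]⁰ L) := by
    intro p hp n z hz
    rw [mul_comm]
    refine (FractionalIdeal.mem_inv_iff I.val.ne_zero).1 hz _ ?_
    change _ ∈ I.ideal
    rw [hIH]
    exact FractionalIdeal.mem_coeIdeal_of_mem _ (hmono p hp n)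
  refine exists_extend_of_coeff_mul_mem I u ?_ ?_ ?_
  · intro y hy
    rw [hIH] at hy
    obtain ⟨p, hp, rfl⟩ := (FractionalIdeal.mem_coeIdeal _).1 hy
    obtain ⟨q, rfl⟩ := X_pow_dvd_iff.2 fun k hk => hmin k hk p hp
    exact ⟨q.map (algebraMap A K), by simp [u]⟩
  · intro z hz
    obtain ⟨q, hq⟩ := exists_polynomialMap_of_mem_one (A := A) (K := K) (hmon p₀ hp₀ m z hz)
    refine exists_polynomialMap_eq (c := algebraMap A K (p₀.coeff m)) (by simpa using ha) (q := q) ?_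
    rw [hq, ← C_mul_X_pow_eq_monomial]
    simp [u, mul_assoc]
  · intro p q hp z hz hq n k
    rw [hu, hIH] at hp
    obtain ⟨r, hr, hrp⟩ := (FractionalIdeal.mem_coeIdeal _).1 hp
    rw [← polynomialMap_map (K := K)] at hrp
    have hrp := polynomialMap_injective A K L hrp
    -- The monomial of degree n + m of X^m p lies in H, so its product with z, which is p_n X^n q,
    -- has coefficients in A; the one in degree k + n is p_n q_k.
    have h1 := hmon r hr (n + m) z hz
    have h2 : algebraMap A[X] L (monomial (n + m) (r.coeff (n + m))) * z =
        polynomialMap A K L (C (p.coeff n) * X ^ n * q) := by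
      have h3 : algebraMap A K (r.coeff (n + m)) = p.coeff n := by
        rw [← coeff_map, hrp, coeff_X_pow_mul]
      rw [map_mul, hq, map_mul, polynomialMap_C, ← h3, fractionMap_algebraMap,
        ← C_mul_X_pow_eq_monomial]
      simp only [u, map_mul, map_pow, polynomialMap_X, Units.val_mk0]
      ring
    rw [h2, polynomialMap_mem_one] at h1
    have h4 := h1 (k + n)
    rwa [mul_assoc, coeff_C_mul, coeff_X_pow_mul] at h4

lemma exists_extend_of_isHomogeneousFractional (I : TInvertible A[X] L)
    (hI : IsHomogeneousFractional (polynomialGrading A) I.ideal) :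
    ∃ (w : Lˣ) (J : TInvertible A K), I = principal A[X] L w * TInvertible.extend A K L J := by
  obtain ⟨s, hs, -, H, hH, hsI⟩ := hI
  let u : Lˣ := Units.mk0 (algebraMap A[X] L s) (by simpa using hs)
  obtain ⟨w, J, h⟩ := exists_extend_of_homogeneous_ideal (K := K) (principal A[X] L u * I) H hH
    (by rw [TInvertible.principal_mul_ideal, ← hsI]; rfl)
  exact ⟨u⁻¹ * w, J, by rw [map_mul, mul_assoc, ← h, ← mul_assoc, ← map_mul]; simp⟩

end Homogeneous

/-! ### Integrally closed A: Gauss's lemma and surjectivity -/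

section IntegrallyClosed

/-- Gauss's lemma for a valuation: the content of a product is the product of the contents. -/
lemma _root_.Valuation.coeff_mul_coeff_le {F Γ : Type*} [Field F]
    [LinearOrderedCommGroupWithZero Γ] (v : Valuation F Γ) {f g : F[X]} {γ : Γ}
    (h : ∀ n, v ((f * g).coeff n) ≤ γ) (i j : ℕ) : v (f.coeff i * g.coeff j) ≤ γ := by
  rcases eq_or_ne f 0 with rfl | hf
  · simp
  rcases eq_or_ne g 0 with rfl | hg
  · simp
  have key (p : F[X]) (hp : p ≠ 0) : ∃ m, v (p.coeff m) ≠ 0 ∧ (∀ k, v (p.coeff k) ≤ v (p.coeff m)) ∧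
      ∀ k < m, v (p.coeff k) < v (p.coeff m) := by
    have hex : ∃ m, ∀ k, v (p.coeff k) ≤ v (p.coeff m) := by
      obtain ⟨m, -, hm⟩ := p.support.exists_max_image (fun k => v (p.coeff k))
        (nonempty_support_iff.2 hp)
      refine ⟨m, fun k => ?_⟩
      by_cases hk : k ∈ p.support
      · exact hm k hk
      · simp [notMem_support_iff.1 hk]
    classical
    -- The least index of maximal value; a maximal value 0 would make p vanish.
    refine ⟨Nat.find hex, fun h0 => hp (Polynomial.ext fun k => ?_), Nat.find_spec hex,
      fun k hk => ?_⟩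
    · have := Nat.find_spec hex k
      rw [h0] at this
      simpa using this
    · obtain ⟨l, hl⟩ := not_forall.1 (Nat.find_min hex hk)
      exact (not_le.1 hl).trans_le (Nat.find_spec hex l)
  obtain ⟨m, hm0, hm, hm'⟩ := key f hf
  obtain ⟨n, hn0, hn, hn'⟩ := key g hg
  have hmn : v ((f * g).coeff (m + n)) = v (f.coeff m) * v (g.coeff n) := by
    rw [← map_mul, coeff_mul]
    classical
    rw [← Finset.add_sum_erase _ _ (Finset.HasAntidiagonal.mem_antidiagonal.2 rfl :
      (m, n) ∈ Finset.HasAntidiagonal.antidiagonal (m + n))]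
    refine v.map_add_eq_of_lt_left ?_
    refine v.map_sum_lt (by simpa using ⟨(v.ne_zero_iff).1 hm0, v.ne_zero_iff.1 hn0⟩) ?_
    rintro ⟨a, b⟩ hab
    rw [Finset.mem_erase, Finset.HasAntidiagonal.mem_antidiagonal] at hab
    obtain ⟨hne, hab⟩ := hab
    rw [map_mul, map_mul]
    dsimp only at hab ⊢
    -- Any other pair with a + b = m + n has a < m or b < n, so its term is strictly smaller and
    -- cannot cancel the term at (m, n).
    rcases lt_trichotomy a m with ha | rfl | ha
    · exact mul_lt_mul_of_lt_of_le_of_nonneg_of_pos (hm' a ha) (hn b) zero_le (zero_lt_iff.2 hn0)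
    · exact absurd (by simpa using hab) (fun h : b = n => hne (by rw [h]))
    · exact mul_lt_mul_of_le_of_lt_of_nonneg_of_pos (hm a) (hn' b (by omega)) zero_le
        (zero_lt_iff.2 hm0)
  calc v (f.coeff i * g.coeff j) = v (f.coeff i) * v (g.coeff j) := map_mul _ _ _
    _ ≤ v (f.coeff m) * v (g.coeff n) := mul_le_mul' (hm i) (hn j)
    _ ≤ γ := hmn ▸ h _

variable {A K L : Type*} [CommRing A] [IsDomain A] [Field K] [Algebra A K] [IsFractionRing A K]
  [Field L] [Algebra A[X] L] [IsFractionRing A[X] L]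

/-- Over an integrally closed domain, if `f g` has coefficients in `A`, then so do all products of a
coefficient of `f` and a coefficient of `g`. -/
lemma coeff_mul_coeff_mem_one [IsIntegrallyClosed A] {f g : K[X]}
    (h : ∀ n, (f * g).coeff n ∈ (1 : FractionalIdeal A⁰ K)) (i j : ℕ) :
    f.coeff i * g.coeff j ∈ (1 : FractionalIdeal A⁰ K) := by
  have hmem : ∀ x : K, x ∈ (1 : FractionalIdeal A⁰ K) ↔ x ∈ (algebraMap A K).range := fun x => by
    rw [FractionalIdeal.mem_one_iff]; rfl
  simp_rw [hmem] at h ⊢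
  by_contra hx
  have : IsIntegrallyClosedIn (algebraMap A K).range K := by
    refine isIntegrallyClosedIn_iff.2 ⟨Subtype.val_injective, fun {x} hx => ?_⟩
    have hx : IsIntegral A x := by
      obtain ⟨p, hp, hpx⟩ := hx
      obtain ⟨q, hq, -, hq'⟩ := lifts_and_natDegree_eq_and_monic
        ((mem_lifts p).2 (map_surjective _ (algebraMap A K).rangeRestrict_surjective p)) hp
      refine ⟨q, hq', ?_⟩
      rw [← hq, eval₂_map] at hpx
      exact hpx
    obtain ⟨a, ha⟩ := (IsIntegrallyClosed.isIntegral_iff (R := A)).1 hx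
    exact ⟨⟨x, a, ha⟩, rfl⟩
  -- An integrally closed domain is the intersection of the valuation rings of K above it, so some V
  -- separates the product from A; Gauss's lemma for V with bound 1 contradicts this.
  obtain ⟨V, hV, hxV⟩ := Subring.exists_le_valuationSubring_of_isIntegrallyClosedIn hx
  refine hxV ((V.valuation_le_one_iff _).1 ?_)
  exact V.valuation.coeff_mul_coeff_le (fun n => (V.valuation_le_one_iff _).2 (hV (h n))) i j

variable (A K) in
/-- The ideal of `K[X]` of all polynomials having a multiple by a nonzero element of `A` in the
fractional ideal `I` of `A[X]`. -/
def polynomialIdeal (I : FractionalIdeal A[X]⁰ L) : Ideal K[X] where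
  carrier := {p | ∃ s : A, s ≠ 0 ∧ polynomialMap A K L (C (algebraMap A K s) * p) ∈ I}
  zero_mem' := ⟨1, one_ne_zero, by
    rw [mul_zero, map_zero]; exact Submodule.zero_mem (I : Submodule A[X] L)⟩
  add_mem' := by
    rintro p q ⟨s, hs, hp⟩ ⟨t, ht, hq⟩
    refine ⟨s * t, mul_ne_zero hs ht, ?_⟩
    have h := Submodule.add_mem (I : Submodule A[X] L)
      (Submodule.smul_mem (I : Submodule A[X] L) (C t) hp)
      (Submodule.smul_mem (I : Submodule A[X] L) (C s) hq)
    rw [FractionalIdeal.mem_coe] at h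
    convert h using 1
    simp only [Algebra.smul_def, map_mul, map_add, polynomialMap_C, fractionMap_algebraMap]
    ring
  smul_mem' := by
    rintro r p ⟨s, hs, hp⟩
    -- The scalar r has coefficients in K, so its denominator t is absorbed into s.
    obtain ⟨t, q, ht, hq⟩ := exists_C_mul_eq_map A K r
    refine ⟨s * t, mul_ne_zero hs ht, ?_⟩
    have h := Submodule.smul_mem (I : Submodule A[X] L) q hp
    rw [FractionalIdeal.mem_coe] at h
    convert h using 1
    rw [smul_eq_mul, Algebra.smul_def, ← polynomialMap_map A K L, ← map_mul, ← hq, map_mul (algebraMap A K), C_mul]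
    congr 1
    ring

lemma exists_extend_of_isIntegrallyClosed [IsIntegrallyClosed A] (I : TInvertible A[X] L) :
    ∃ (w : Lˣ) (J : TInvertible A K), I = principal A[X] L w * TInvertible.extend A K L J := by
  have hI0 : I.ideal ≠ 0 := I.val.ne_zero
  obtain ⟨d, hd, hdI⟩ := I.ideal.isFractional
  have hd0 : algebraMap A[X] L d ≠ 0 := by simpa using nonZeroDivisors.ne_zero hd
  let v : Lˣ := Units.mk0 _ hd0
  -- Here d clears the denominators of I, and N is the ideal of `K[X]` generated by dI, hence
  -- principal.
  let N := polynomialIdeal A K (FractionalIdeal.spanSingleton A[X]⁰ (v : L) * I.ideal)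
  have hN : ∀ p s, polynomialMap A K L (C (algebraMap A K s) * p) ∈
      FractionalIdeal.spanSingleton A[X]⁰ (v : L) * I.ideal ↔
      (v⁻¹ : Lˣ) * polynomialMap A K L (C (algebraMap A K s) * p) ∈ I.ideal := fun p s => by
    rw [FractionalIdeal.mem_singleton_mul]
    exact ⟨fun ⟨y, hy, h⟩ => by rw [h]; simpa using hy, fun h => ⟨_, h, by simp⟩⟩
  obtain ⟨g, hg⟩ := (IsPrincipalIdealRing.principal N).principal
  have hmemN : ∀ y ∈ I.ideal, ∃ p ∈ N, polynomialMap A K L p = v * y := by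
    intro y hy
    obtain ⟨b, hb⟩ := hdI y hy
    rw [Algebra.smul_def] at hb
    refine ⟨b.map (algebraMap A K), ⟨1, one_ne_zero, ?_⟩, by rw [polynomialMap_map, hb]; rfl⟩
    rw [hN, map_one, map_one, one_mul, polynomialMap_map, hb]
    simpa [v, hd0] using hy
  have hgen : ∀ p ∈ N, ∃ r, r * g = p := fun p hp => by
    rw [hg] at hp
    exact Submodule.mem_span_singleton.1 hp
  have hg0 : polynomialMap A K L g ≠ 0 := by
    intro h
    obtain ⟨y, hy, hy0⟩ := exists_mem_ne_zero hI0
    obtain ⟨p, hp, hpy⟩ := hmemN y hy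
    obtain ⟨r, rfl⟩ := hgen p hp
    rw [map_mul, h, mul_zero] at hpy
    exact mul_ne_zero v.ne_zero hy0 hpy.symm
  obtain ⟨s, hs, hsg⟩ : g ∈ N := hg ▸ Submodule.mem_span_singleton_self g
  rw [hN] at hsg
  -- Thus u = g/d: all of I lies in uK[X], while su ∈ I for a nonzero constant s, which makes uz a
  -- polynomial for z ∈ I⁻¹.
  let u : Lˣ := v⁻¹ * Units.mk0 _ hg0
  have hinv : ∀ z ∈ I.ideal⁻¹, ∀ y ∈ I.ideal, z * y ∈ (1 : FractionalIdeal A[X]⁰ L) :=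
    fun z hz => (FractionalIdeal.mem_inv_iff hI0).1 hz
  refine exists_extend_of_coeff_mul_mem I u ?_ ?_ ?_
  · intro y hy
    obtain ⟨p, hp, hpy⟩ := hmemN y hy
    obtain ⟨r, rfl⟩ := hgen p hp
    refine ⟨r, ?_⟩
    rw [map_mul] at hpy
    simp only [u, Units.val_mul, Units.val_mk0]
    rw [mul_assoc, mul_comm (polynomialMap A K L g), hpy, Units.inv_mul_cancel_left]
  · intro z hz
    obtain ⟨q, hq⟩ := exists_polynomialMap_of_mem_one (A := A) (K := K) (hinv z hz _ hsg)
    refine exists_polynomialMap_eq (c := algebraMap A K s) (by simpa using hs) (q := q) ?_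
    rw [hq, map_mul, polynomialMap_C]
    simp only [u, Units.val_mul, Units.val_mk0]
    ring
  · intro p q hp z hz hq n m
    have h1 := hinv z hz _ hp
    rw [← mul_assoc, mul_comm z, ← hq, ← map_mul, mul_comm, polynomialMap_mem_one] at h1
    exact coeff_mul_coeff_mem_one h1 n m

end IntegrallyClosed

/-! ### A class not extended from A when A is not integrally closed -/

section NotIntegrallyClosed

variable {A K L : Type*} [CommRing A] [IsDomain A] [Field K] [Algebra A K] [IsFractionRing A K]
  [Field L] [Algebra A[X] L] [IsFractionRing A[X] L]

/-- If an ideal of `A[X]` contains a monic polynomial and a nonzero constant, then its `t`-closure is `A[X]`. -/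
lemma tClosure_eq_one_of_monic {H : FractionalIdeal A[X]⁰ L} (hH : H ≤ 1) {a : A} (ha : a ≠ 0)
    (haH : algebraMap A[X] L (C a) ∈ H) {f : A[X]} (hf : f.Monic)
    (hfH : algebraMap A[X] L f ∈ H) : tClosure H = 1 := by
  refine le_antisymm ((tClosure_mono hH).trans tClosure_one.le) ?_
  let F : FractionalIdeal A[X]⁰ L := FractionalIdeal.spanSingleton A[X]⁰ (algebraMap A[X] L (C a)) ⊔
    FractionalIdeal.spanSingleton A[X]⁰ (algebraMap A[X] L f)
  have haF : algebraMap A[X] L (C a) ∈ F :=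
    (le_sup_left : _ ≤ F) (FractionalIdeal.mem_spanSingleton_self _ _)
  have hfF : algebraMap A[X] L f ∈ F :=
    (le_sup_right : _ ≤ F) (FractionalIdeal.mem_spanSingleton_self _ _)
  have hF0 : F ≠ 0 := fun h => by
    rw [h, FractionalIdeal.mem_zero_iff] at haF
    simp [ha] at haF
  refine FractionalIdeal.one_le.2 (mem_tClosure.2 ⟨F, ?_, ?_, ?_⟩)
  · rw [FractionalIdeal.coe_sup]
    exact (spanSingleton_fg _).sup (spanSingleton_fg _)
  · exact sup_le (FractionalIdeal.spanSingleton_le_iff_mem.2 haH)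
      (FractionalIdeal.spanSingleton_le_iff_mem.2 hfH)
  -- That 1 ∈ F_v means F⁻¹ ⊆ `A[X]`. For y ∈ F⁻¹ put p = ya and q = yf; it suffices that a divides
  -- p.
  · refine (FractionalIdeal.mem_inv_iff (inv_ne_zero' hF0)).2 fun y hy => ?_
    rw [one_mul]
    rw [FractionalIdeal.mem_inv_iff hF0] at hy
    obtain ⟨p, hp⟩ := (FractionalIdeal.mem_one_iff _).1 (hy _ haF)
    obtain ⟨q, hq⟩ := (FractionalIdeal.mem_one_iff _).1 (hy _ hfF)
    have hpq : p * f = C a * q := IsFractionRing.injective A[X] L (by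
      rw [map_mul, map_mul, hp, hq]; ring)
    -- A monic polynomial stays a non-zero-divisor modulo a, and pf = aq vanishes there.
    obtain ⟨r, rfl⟩ : C a ∣ p := by
      rw [C_dvd_iff_dvd_coeff]
      have h0 : (p * f).map (Ideal.Quotient.mk (Ideal.span {a})) = 0 := by
        rw [hpq, Polynomial.map_mul, map_C,
          Ideal.Quotient.eq_zero_iff_mem.2 (Ideal.mem_span_singleton_self a), C_0, zero_mul]
      rw [Polynomial.map_mul] at h0
      have h1 := (hf.map (Ideal.Quotient.mk (Ideal.span {a}))).mul_left_eq_zero_iff.1 h0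
      intro n
      rw [← Ideal.mem_span_singleton, ← Ideal.Quotient.eq_zero_iff_mem, ← coeff_map, h1, coeff_zero]
    refine (FractionalIdeal.mem_one_iff _).2 ⟨r, ?_⟩
    have haL : algebraMap A[X] L (C a) ≠ 0 := by simpa using ha
    refine mul_left_cancel₀ haL ?_
    rw [← map_mul, hp, mul_comm]

/-- If `A` is not integrally closed, there is a `t`-invertible `t`-ideal of `A[X]` which
is not a multiple of an extended ideal. -/
lemma exists_ne_extend (h : ¬ IsIntegrallyClosed A) : ∃ I : TInvertible A[X] L,
    ∀ (w : Lˣ) (J : TInvertible A K), I ≠ principal A[X] L w * TInvertible.extend A K L J := by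
  obtain ⟨u, hu, huA⟩ : ∃ u : K, IsIntegral A u ∧ ¬ ∃ a, algebraMap A K a = u := by
    by_contra! hcon
    exact h ((isIntegrallyClosed_iff K).2 fun {x} hx => hcon x hx)
  obtain ⟨f, hf, hfu⟩ := hu
  obtain ⟨g, hg⟩ : X - C u ∣ f.map (algebraMap A K) := dvd_iff_isRoot.2 (by
    rwa [IsRoot.def, eval_map])
  have hgm : g.Monic := (monic_X_sub_C u).of_mul_monic_left (hg ▸ hf.map _)
  obtain ⟨b, ub, hb, hub⟩ := exists_C_mul_eq_map A K (X - C u)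
  obtain ⟨b', gb, hb', hgb⟩ := exists_C_mul_eq_map A K g
  have hC (a : A) : polynomialMap A K L (C (algebraMap A K a)) = algebraMap A[X] L (C a) := by simp
  let W : FractionalIdeal A[X]⁰ L := FractionalIdeal.spanSingleton A[X]⁰ (algebraMap A[X] L (C b)) ⊔
    FractionalIdeal.spanSingleton A[X]⁰ (polynomialMap A K L g)
  have hbW : algebraMap A[X] L (C b) ∈ W :=
    (le_sup_left : _ ≤ W) (FractionalIdeal.mem_spanSingleton_self _ _)
  have hgW : polynomialMap A K L g ∈ W :=
    (le_sup_right : _ ≤ W) (FractionalIdeal.mem_spanSingleton_self _ _)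
  have hW0 : W ≠ 0 := fun h => by
    rw [h, FractionalIdeal.mem_zero_iff] at hbW
    simp [hb] at hbW
  have hWinv : ∀ z p q, z * algebraMap A[X] L (C b) = algebraMap A[X] L p →
      z * polynomialMap A K L g = algebraMap A[X] L q → z ∈ W⁻¹ := fun z p q hp hq => by
    rw [← FractionalIdeal.spanSingleton_le_iff_mem]
    refine mem_inv_of_mul_le_one hW0 ?_
    change _ * (_ ⊔ _) ≤ _
    rw [FractionalIdeal.sup_eq_add, mul_add, FractionalIdeal.spanSingleton_mul_spanSingleton,
      FractionalIdeal.spanSingleton_mul_spanSingleton, ← FractionalIdeal.sup_eq_add, hp, hq]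
    exact sup_le
      (FractionalIdeal.spanSingleton_le_iff_mem.2 ((FractionalIdeal.mem_one_iff _).2 ⟨p, rfl⟩))
      (FractionalIdeal.spanSingleton_le_iff_mem.2 ((FractionalIdeal.mem_one_iff _).2 ⟨q, rfl⟩))
  have hXu : polynomialMap A K L (X - C u) ∈ W⁻¹ := hWinv _ ub f
    (by rw [← hC, ← map_mul, mul_comm, hub, polynomialMap_map])
    (by rw [← map_mul, ← hg, polynomialMap_map])
  have hb'W : algebraMap A[X] L (C b') ∈ W⁻¹ := hWinv _ (C b' * C b) gb
    (by rw [map_mul]) (by rw [← hC, ← map_mul, hgb, polynomialMap_map])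
  have hWW : tClosure (W * W⁻¹) = 1 := by
    refine tClosure_eq_one_of_monic (a := b * b') (by rw [mul_comm]; exact inv_mul_le_one W)
      (mul_ne_zero hb hb') ?_ hf ?_
    · rw [C_mul, map_mul]
      exact FractionalIdeal.mul_mem_mul hbW hb'W
    · rw [← polynomialMap_map (K := K), hg, mul_comm (X - C u), map_mul]
      exact FractionalIdeal.mul_mem_mul hgW hXu
  refine ⟨TInvertible.ofMul W W⁻¹ hWW, fun w J hwJ => huA ?_⟩
  have hI : tClosure W = FractionalIdeal.spanSingleton A[X]⁰ (w : L) *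
      FractionalIdeal.extendedHom L A[X] J.ideal := by
    rw [← TInvertible.ofMul_ideal W W⁻¹ hWW, hwJ, TInvertible.principal_mul_ideal,
      TInvertible.extend_ideal]
  have hmem : ∀ y, y ∈ tClosure W ↔
      ∃ p : K[X], (∀ n, p.coeff n ∈ J.ideal) ∧ w * polynomialMap A K L p = y := fun y => by
    rw [hI, FractionalIdeal.mem_singleton_mul]
    constructor
    · rintro ⟨x, hx, rfl⟩
      obtain ⟨p, hp, rfl⟩ := mem_extendedHom.1 hx
      exact ⟨p, hp, rfl⟩
    · rintro ⟨p, hp, rfl⟩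
      exact ⟨_, polynomialMap_mem_extendedHom.2 hp, rfl⟩
  have hmulW : ∀ y ∈ tClosure W, ∀ z ∈ W⁻¹, z * y ∈ (1 : FractionalIdeal A[X]⁰ L) := by
    intro y hy z hz
    rw [← inv_tClosure] at hz
    exact (FractionalIdeal.mem_inv_iff (tClosure_ne_zero hW0)).1 hz y hy
  -- The constant b' ∈ W⁻¹ = (W_t)⁻¹ carries W_t into `A[X]`.
  have hpoly : ∀ y ∈ tClosure W, ∃ p, polynomialMap A K L p = y := by
    intro y hy
    obtain ⟨q, hq⟩ := exists_polynomialMap_of_mem_one (A := A) (K := K) (hmulW y hy _ hb'W)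
    exact exists_polynomialMap_eq (c := algebraMap A K b') (by simpa using hb') (q := q)
      (by rw [hq, fractionMap_algebraMap])
  obtain ⟨j, hj, hj0⟩ := exists_mem_ne_zero J.val.ne_zero
  change j ∈ J.ideal at hj
  have hjW : w * polynomialMap A K L (C j) ∈ tClosure W :=
    (hmem _).2 ⟨C j, fun n => by
      rw [coeff_C]
      split_ifs
      exacts [hj, Submodule.zero_mem (J.ideal : Submodule A K)], rfl⟩
  obtain ⟨q, hq⟩ := hpoly _ hjW
  rw [polynomialMap_C] at hq
  -- The multiplier w is a polynomial since wj is one. It divides the nonzero constant b in `K[X]`,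
  -- so it is itself a constant c.
  obtain ⟨r, hr⟩ := exists_polynomialMap_eq hj0 (hq.trans (mul_comm _ _))
  obtain ⟨p, hp, hpb⟩ := (hmem _).1 (le_tClosure W hbW)
  have hrp : r * p = C (algebraMap A K b) :=
    polynomialMap_injective A K L (by rw [map_mul, hr, hpb, hC])
  have hru : IsUnit r := isUnit_of_mul_isUnit_left (y := p) (by
    rw [hrp]
    exact isUnit_C.2 (by simpa using hb))
  obtain ⟨c, hc, rfl⟩ := Polynomial.isUnit_iff.1 hru
  obtain ⟨p', hp', hpg⟩ := (hmem _).1 (le_tClosure W hgW)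
  have hcp : C c * p' = g := polynomialMap_injective A K L (by rw [map_mul, hr, hpg])
  -- As g = cp' is monic with the coefficients of p' in J, its leading coefficient 1 lies in cJ ⊆
  -- W_t.
  have h1W : (1 : L) ∈ tClosure W := by
    refine (hmem _).2 ⟨C (p'.coeff g.natDegree), fun n => ?_, ?_⟩
    · rw [coeff_C]
      split_ifs
      exacts [hp' _, Submodule.zero_mem (J.ideal : Submodule A K)]
    · rw [← hr, ← map_mul, ← C_mul, ← coeff_C_mul, hcp, coeff_natDegree, hgm.leadingCoeff]
      simp
  have h2 := hmulW 1 h1W _ hXu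
  rw [mul_one, polynomialMap_mem_one] at h2
  obtain ⟨a, ha⟩ := (FractionalIdeal.mem_one_iff _).1 (h2 0)
  exact ⟨-a, by rw [map_neg, ha]; simp⟩

end NotIntegrallyClosed

/-! ### The homomorphism of class groups -/

section ClassGroup

variable (A : Type*) [CommRing A] [IsDomain A]

/-- The homomorphism `Cl(A) → Cl(A[X])`, `[J] ↦ [J A[X]]`. -/
def Cl.extend : Cl A →* Cl A[X] :=
  QuotientGroup.map _ _ (TInvertible.extend A (FractionRing A) (FractionRing A[X])) (by
    rintro _ ⟨u, rfl⟩
    exact ⟨_, (extend_principal u).symm⟩)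

variable {A}

lemma Cl.mk_eq_mk {R : Type*} [CommRing R] [IsDomain R] {I J : TInvertible R (FractionRing R)} :
    Cl.mk I = Cl.mk J ↔ ∃ u, I = principal R (FractionRing R) u * J := by
  rw [eq_comm, Cl.mk, QuotientGroup.mk'_eq_mk']
  constructor
  · rintro ⟨_, ⟨u, rfl⟩, h⟩
    exact ⟨u, by rw [← h, mul_comm]⟩
  · rintro ⟨u, rfl⟩
    exact ⟨_, ⟨u, rfl⟩, mul_comm _ _⟩

lemma Cl.extend_mk (J : TInvertible A (FractionRing A)) : Cl.extend A (Cl.mk J) =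
    Cl.mk (TInvertible.extend A (FractionRing A) (FractionRing A[X]) J) := rfl

lemma Cl.mk_mem_range_extend {I : TInvertible A[X] (FractionRing A[X])} :
    Cl.mk I ∈ (Cl.extend A).range ↔ ∃ u J, I = principal A[X] (FractionRing A[X]) u *
      TInvertible.extend A (FractionRing A) (FractionRing A[X]) J := by
  constructor
  · rintro ⟨x, hx⟩
    obtain ⟨J, rfl⟩ := QuotientGroup.mk'_surjective _ x
    obtain ⟨u, hu⟩ := Cl.mk_eq_mk.1 hx.symm
    exact ⟨u, J, hu⟩
  · rintro ⟨u, J, hu⟩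
    exact ⟨Cl.mk J, (Cl.mk_eq_mk.2 ⟨u, hu⟩).symm⟩

/-- If J[X] is generated by u, then u is a polynomial p over K dividing every nonzero constant j ∈ J
in `K[X]`. So p is a constant c, and J[X] = cA[X] descends to J = cA. -/
lemma Cl.extend_injective : Function.Injective (Cl.extend A) := by
  refine (injective_iff_map_eq_one _).2 fun x hx => ?_
  obtain ⟨J, rfl⟩ := QuotientGroup.mk'_surjective _ x
  change Cl.extend A (Cl.mk J) = 1 at hx
  rw [Cl.extend_mk, ← map_one Cl.mk, Cl.mk_eq_mk] at hx
  obtain ⟨u, hu⟩ := hx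
  have hJ : FractionalIdeal.extendedHom (FractionRing A[X]) A[X] J.ideal =
      FractionalIdeal.spanSingleton A[X]⁰ (u : FractionRing A[X]) := by
    rw [← TInvertible.extend_ideal, hu, mul_one, principal_ideal]
  obtain ⟨p, hp, hpu⟩ := mem_extendedHom.1
    (hJ ▸ FractionalIdeal.mem_spanSingleton_self A[X]⁰ (u : FractionRing A[X]))
  obtain ⟨j, hj, hj0⟩ := exists_mem_ne_zero J.val.ne_zero
  have hju : fractionMap A (FractionRing A) (FractionRing A[X]) j ∈
      FractionalIdeal.spanSingleton A[X]⁰ (u : FractionRing A[X]) :=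
    hJ ▸ fractionMap_mem_extendedHom.2 hj
  obtain ⟨q, hq⟩ := (FractionalIdeal.mem_spanSingleton _).1 hju
  have hqp : q.map (algebraMap A (FractionRing A)) * p = C j :=
    polynomialMap_injective A (FractionRing A) (FractionRing A[X]) (by
      rw [map_mul, polynomialMap_map, hpu, polynomialMap_C, ← hq, Algebra.smul_def])
  have hpunit : IsUnit p := isUnit_of_mul_isUnit_right (by
    rw [hqp]
    exact isUnit_C.2 hj0.isUnit)
  obtain ⟨c, hc, rfl⟩ := Polynomial.isUnit_iff.1 hpunit
  rw [← map_one Cl.mk]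
  refine Cl.mk_eq_mk.2 ⟨hc.unit, ?_⟩
  rw [mul_one]
  refine TInvertible.ideal_injective
    (extendedHom_injective A (FractionRing A) (FractionRing A[X]) ?_)
  rw [hJ, ← TInvertible.extend_ideal, extend_principal, principal_ideal, ← hpu]
  simp

lemma Cl.range_extend : (Cl.extend A).range = HCl (polynomialGrading A) := by
  ext x
  constructor
  · rintro ⟨y, rfl⟩
    obtain ⟨J, rfl⟩ := QuotientGroup.mk'_surjective _ y
    exact ⟨_, isHomogeneousFractional_extendedHom J.ideal, rfl⟩
  · rintro ⟨I, hI, rfl⟩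
    exact Cl.mk_mem_range_extend.2 (exists_extend_of_isHomogeneousFractional I hI)

lemma Cl.range_extend_eq_top : (Cl.extend A).range = ⊤ ↔ IsIntegrallyClosed A := by
  constructor
  · intro h
    by_contra hA
    obtain ⟨I, hI⟩ := exists_ne_extend (K := FractionRing A) (L := FractionRing A[X]) hA
    obtain ⟨u, J, huJ⟩ := Cl.mk_mem_range_extend.1 (h ▸ Subgroup.mem_top (Cl.mk I))
    exact hI u J huJ
  · intro h
    refine (Subgroup.eq_top_iff' _).2 fun x => ?_
    obtain ⟨I, rfl⟩ := QuotientGroup.mk'_surjective _ x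
    exact Cl.mk_mem_range_extend.2 (exists_extend_of_isIntegrallyClosed I)

end ClassGroup

end TClass

end

theorem corollary1p9 (A : Type*) [CommRing A] [IsDomain A] :
    (TClass.HCl (TClass.polynomialGrading A) = ⊤ ↔ IsIntegrallyClosed A) ∧
    ∃ φ : TClass.Cl A →* TClass.Cl A[X],
      (∀ J : TClass.TInvertible A (FractionRing A),
        ∃ I : TClass.TInvertible A[X] (FractionRing A[X]),
          I.ideal = FractionalIdeal.extendedHom (FractionRing A[X]) A[X] J.ideal ∧
          φ (TClass.Cl.mk J) = TClass.Cl.mk I) ∧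
      Function.Injective φ ∧
      φ.range = TClass.HCl (TClass.polynomialGrading A) ∧
      (Function.Surjective φ ↔ IsIntegrallyClosed A) := by
  refine ⟨TClass.Cl.range_extend (A := A) ▸ TClass.Cl.range_extend_eq_top,
    TClass.Cl.extend A, fun J => ⟨TClass.TInvertible.extend _ _ _ J, rfl, rfl⟩,
    TClass.Cl.extend_injective, TClass.Cl.range_extend, ?_⟩
  rw [← MonoidHom.range_eq_top, TClass.Cl.range_extend_eq_top]
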